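/- Let $K$ be a field of characteristic zero, $n\ge 0$ an integer, $P_n=K[x_1,\dots,x_n]$, and let $\mathbb I_n\subseteq \mathrm{End}_K(P_n)$ be the $K$-subalgebra generated by the multiplications by $x_i$, the partial derivatives $\partial_i=\partial/\partial x_i$ and the integrations $\int_i: x^\alpha\mapsto(\alpha_i+1)^{-1}x_ix^\alpha$ ($i=1,\dots,n$). Put $H_i=\partial_ix_i$ and $\partial^\alpha=\partial_1^{\alpha_1}\cdots\partial_n^{\alpha_n}$. Let $\mathfrak p_i$ be the two-sided ideal of $\mathbb I_n$ generated by the elements $\int_i^s\partial_i^t-\int_i^{s+1}\partial_i^{t+1}$ ($s,t\in\mathbb N$), let $\mathfrak a_n=\mathfrak p_1+\cdots+\mathfrak p_n$, $L_n=\mathbb I_n/\mathfrak a_n$ and $\pi:\mathbb I_n\to L_n$ the projection; write $\overline S=\pi(S)$. Let $\Delta_n$ be the subalgebra of $\mathbb I_n$ generated by $H_1,\dots,H_n,\partial_1,\dots,\partial_n$. For a ring $R$, a *multiplicative set* is a subset $S$ with $1\in S$, $SS\subseteq S$, $0\notin S$. It is a *left denominator set* if for all $r\in R$, $s\in S$ we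 have $Sr\cap Rs\ne\emptyset$, and $rs=0$ implies $r\in\mathrm{ass}(S):=\{r\in R: s'r=0\text{ for some }s'\in S\}$. For an ideal $\mathfrak a$, $\mathrm{Den}_l(R,\mathfrak a)$ is the set of left denominator sets $S$ with $\mathrm{ass}(S)=\mathfrak a$, and $S^{-1}R$ is the left localization. Let ${}'\mathcal C_R=\{c\in R: rc=0\Rightarrow r=0\}$, let ${}'S(R)$ be the largest left denominator set of $R$ contained in ${}'\mathcal C_R$, and ${}'Q(R)={}'S(R)^{-1}R$. Put $${}'\Delta_n=\Delta_n\cap{}'S(\mathbb I_n),\qquad \widetilde{{}'\Delta_n}=\{c\in\Delta_n:\ \partial^\alpha c\in{}'S(\mathbb I_n)\text{ for some }\alpha\in\mathbb N^n\},$$ $${}''\Delta_n=\bigl({}'S(\mathbb I_n)\cap({}'\mathcal C_{\Delta_n+\mathfrak a_n}+\mathfrak a_n)\bigr)+\mathfrak a_n,$$ where ${}'\mathcal C_{\Delta_n+\mathfrak a_n}$ is formed in the ring $\Delta_n+\mathfrak a_n$. All isomorphisms below are ring isomorphisms compatible with the canonical homomorphisms from $\mathbb I_n$ (in part 6, from $\Delta_n$).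 **Theorem.** 1. ${}'\Delta_n\in\mathrm{Den}_l(\mathbb I_n,\mathfrak a_n)$ and ${}'\Delta_n^{-1}\mathbb I_n\simeq{}'Q(\mathbb I_n)$. Moreover, ${}'\mathcal C_{\mathbb I_n}\cap\Delta_n$ is a multiplicative set, and ${}'\Delta_n$ is the largest left denominator set of $\mathbb I_n$ contained in it. 2. ${}'\Delta_n+\mathfrak a_n,\ {}'S(\mathbb I_n)+\mathfrak a_n\in\mathrm{Den}_l(\mathbb I_n,\mathfrak a_n)$ and $({}'\Delta_n+\mathfrak a_n)^{-1}\mathbb I_n\simeq({}'S(\mathbb I_n)+\mathfrak a_n)^{-1}\mathbb I_n\simeq{}'Q(\mathbb I_n)$. 3. The map $\pi$ is injective on $\Delta_n$ (so that ${}'\Delta_n$ is identified with $\overline{{}'\Delta_n}$). Each of the sets $S=\overline{{}'\Delta_n},\ \overline{{}'\Delta_n+\mathfrak a_n},\ \overline{{}'S(\mathbb I_n)+\mathfrak a_n}$ belongs to $\mathrm{Den}_l(L_n,0)$ and satisfies $S^{-1}L_n\simeq{}'Q(\mathbb I_n)$. 4. $\widetilde{{}'\Delta_n}\in\mathrm{Den}_l(\mathbb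 I_n,\mathfrak a_n)$ and $\widetilde{{}'\Delta_n}^{-1}\mathbb I_n\simeq{}'Q(\mathbb I_n)$; and $\overline{\widetilde{{}'\Delta_n}}\in\mathrm{Den}_l(L_n,0)$ and $\overline{\widetilde{{}'\Delta_n}}^{-1}L_n\simeq{}'Q(\mathbb I_n)$. 5. $\widetilde{{}'\Delta_n}+\mathfrak a_n\in\mathrm{Den}_l(\mathbb I_n,\mathfrak a_n)$ and $(\widetilde{{}'\Delta_n}+\mathfrak a_n)^{-1}\mathbb I_n\simeq{}'Q(\mathbb I_n)$. 6. ${}'\Delta_n\in\mathrm{Den}_l(\Delta_n,0)$ and ${}'\Delta_n^{-1}\Delta_n\simeq{}'Q(\mathbb I_n)$. 7. ${}''\Delta_n\in\mathrm{Den}_l(\mathbb I_n,\mathfrak a_n)$, ${}'\Delta_n\subseteq{}''\Delta_n$ and ${}''\Delta_n^{-1}\mathbb I_n\simeq{}'Q(\mathbb I_n)$. The same three assertions hold for the set ${}'S(\mathbb I_n)\cap({}'\mathcal C_{\Delta_n+\mathfrak a_n}+\mathfrak a_n)$ in place of ${}''\Delta_n$. -/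

import Mathlib

open scoped Pointwise

namespace IntDiff

/-! ### Left Ore sets, left denominator sets and left localization -/

section General

variable {R : Type*} [Ring R]

/-- Multiplicative sets: `1 ∈ S`, `S S ⊆ S` and `0 ∉ S`. -/
structure IsMultiplicativeSet (S : Set R) : Prop where
  one_mem : (1 : R) ∈ S
  mul_mem : ∀ s ∈ S, ∀ t ∈ S, s * t ∈ S
  zero_notMem : (0 : R) ∉ S

/-- Left Ore sets: multiplicative sets with `S r ∩ R s ≠ ∅` for all `r ∈ R` and `s ∈ S`. -/
structure IsLeftOreSet (S : Set R) : Prop extends IsMultiplicativeSet S where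
  ore : ∀ r : R, ∀ s ∈ S, ∃ s' ∈ S, ∃ r' : R, s' * r = r' * s

/-- `ass_l(S) = {r ∈ R | s r = 0 for some s ∈ S}`. -/
def leftAss (S : Set R) : Set R := {r | ∃ s ∈ S, s * r = 0}

/-- Left denominator sets: left Ore sets such that `r s = 0` with `s ∈ S` implies
`r ∈ ass_l(S)`. -/
structure IsLeftDenominatorSet (S : Set R) : Prop extends IsLeftOreSet S where
  mem_leftAss : ∀ r : R, ∀ s ∈ S, r * s = 0 → r ∈ leftAss S

/-- `S ∈ Den_l(R, 𝔞)`: a left denominator set with `ass_l(S) = 𝔞`. -/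
structure IsLeftDenominatorSetWith (S : Set R) (𝔞 : Ideal R) : Prop
    extends IsLeftDenominatorSet S where
  leftAss_eq : leftAss S = (𝔞 : Set R)

/-- A left denominator set as a submonoid. -/
def IsLeftDenominatorSet.submonoid {S : Set R} (h : IsLeftDenominatorSet S) : Submonoid R where
  carrier := S
  one_mem' := h.one_mem
  mul_mem' := fun {a b} ha hb => h.mul_mem a ha b hb

/-- Mathlib's Ore condition (which is the one for left fractions `s⁻¹ r`). -/
noncomputable instance IsLeftDenominatorSet.oreSet {S : Set R} (h : IsLeftDenominatorSet S) :
    OreLocalization.OreSet h.submonoid where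
  ore_right_cancel := fun r₁ r₂ s hs => by
    obtain ⟨t, ht, e⟩ := h.mem_leftAss (r₁ - r₂) s s.2 (by rw [sub_mul, hs, sub_self])
    exact ⟨⟨t, ht⟩, by rw [mul_sub] at e; exact sub_eq_zero.mp e⟩
  oreNum := fun r s => (h.ore r s s.2).choose_spec.2.choose
  oreDenom := fun r s => ⟨(h.ore r s s.2).choose, (h.ore r s s.2).choose_spec.1⟩
  ore_eq := fun r s => (h.ore r s s.2).choose_spec.2.choose_spec

/-- The left localization `S⁻¹R = {s⁻¹ r | s ∈ S, r ∈ R}` at a left denominator set `S`. -/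
abbrev IsLeftDenominatorSet.Loc {S : Set R} (h : IsLeftDenominatorSet S) :=
  OreLocalization h.submonoid R

/-- The canonical ring homomorphism `R → S⁻¹R`, `r ↦ 1⁻¹ r`. -/
noncomputable def IsLeftDenominatorSet.toLoc {S : Set R} (h : IsLeftDenominatorSet S) :
    R →+* h.Loc :=
  OreLocalization.numeratorRingHom

/-- An `R`-isomorphism between two rings `A` and `B` over `R` (given by ring homomorphisms
`u : R → A` and `v : R → B`): a ring isomorphism `e : A → B` with `e ∘ u = v`. -/
def IsoOver {A B : Type*} [Ring A] [Ring B] (u : R →+* A) (v : R →+* B) : Prop :=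
  ∃ e : A ≃+* B, ∀ r : R, e (u r) = v r

variable (R) in
/-- The set `'C_R` of left regular elements: `r c = 0` implies `r = 0`. -/
def leftRegular : Set R := {c | ∀ r : R, r * c = 0 → r = 0}

/-- For a subring `T` of `R` (given by its set of elements), the set `'C_T` of left regular
elements of the ring `T`. -/
def leftRegularOf (T : Set R) : Set R := {c ∈ T | ∀ r ∈ T, r * c = 0 → r = 0}

variable (R) in
/-- `'S(R)`: the union of the left denominator sets of `R` that are contained in `'C_R`; it is
the largest such set by `isGreatest_largestLeftRegDen`. -/
def largestLeftRegDen : Set R :=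
  ⋃₀ {S : Set R | IsLeftDenominatorSet S ∧ S ⊆ leftRegular R}

variable (R) in
theorem isGreatest_largestLeftRegDen [Nontrivial R] :
    IsGreatest {S : Set R | IsLeftDenominatorSet S ∧ S ⊆ leftRegular R}
      (largestLeftRegDen R) := by
  have key : IsLeftDenominatorSet (Submonoid.closure (largestLeftRegDen R) : Set R) ∧
      (Submonoid.closure (largestLeftRegDen R) : Set R) ⊆ leftRegular R := by
    have hreg : (Submonoid.closure (largestLeftRegDen R) : Set R) ⊆ leftRegular R := by
      intro x hx
      induction hx using Submonoid.closure_induction with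
      | mem x hx =>
        obtain ⟨S, ⟨_, hS⟩, hxS⟩ := hx
        exact hS hxS
      | one => intro r hr; simpa using hr
      | mul x y _ _ hx hy =>
        intro r hr
        exact hx r (hy _ (by rw [mul_assoc]; exact hr))
    refine ⟨⟨⟨⟨Submonoid.one_mem _, fun s hs t ht => Submonoid.mul_mem _ hs ht, ?_⟩, ?_⟩, ?_⟩,
      hreg⟩
    · intro h0
      exact one_ne_zero (hreg h0 1 (mul_zero 1))
    · intro r s hs
      induction hs using Submonoid.closure_induction generalizing r with
      | mem s hs =>
        obtain ⟨S, ⟨hS, hS'⟩, hsS⟩ := hs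
        obtain ⟨s', hs', r', e⟩ := hS.ore r s hsS
        exact ⟨s', Submonoid.subset_closure ⟨S, ⟨hS, hS'⟩, hs'⟩, r', e⟩
      | one => exact ⟨1, Submonoid.one_mem _, r, by simp⟩
      | mul x y _ _ hx hy =>
        obtain ⟨s₁, h₁, r₁, e₁⟩ := hy r
        obtain ⟨s₂, h₂, r₂, e₂⟩ := hx r₁
        exact ⟨s₂ * s₁, Submonoid.mul_mem _ h₂ h₁, r₂,
          by rw [mul_assoc, e₁, ← mul_assoc, e₂, mul_assoc]⟩
    · intro r s hs hrs
      exact ⟨1, Submonoid.one_mem _, by rw [hreg hs r hrs, mul_zero]⟩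
  have heq : largestLeftRegDen R = (Submonoid.closure (largestLeftRegDen R) : Set R) :=
    Set.Subset.antisymm Submonoid.subset_closure (Set.subset_sUnion_of_mem key)
  refine ⟨?_, fun S hS => Set.subset_sUnion_of_mem hS⟩
  rw [heq]
  exact key

variable (R) in
/-- `'Q(R) = 'S(R)⁻¹R`, the left regular left quotient ring of `R`. -/
abbrev LeftRegQuot [Nontrivial R] := (isGreatest_largestLeftRegDen R).1.1.Loc

variable (R) in
/-- The canonical ring homomorphism `R → 'Q(R)`. -/
noncomputable def toLeftRegQuot [Nontrivial R] : R →+* LeftRegQuot R :=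
  (isGreatest_largestLeftRegDen R).1.1.toLoc

end General

/-! ### The algebra of polynomial integro-differential operators -/

section Operators

variable (K : Type*) [Field K] (n : ℕ)

/-- `End_K(P_n)`, where `P_n = K[x_1, …, x_n]`. -/
abbrev EndP := Module.End K (MvPolynomial (Fin n) K)

variable {n}

/-- Multiplication by `x_i` on `P_n`. -/
noncomputable def opX (i : Fin n) : EndP K n := LinearMap.mulLeft K (MvPolynomial.X i)

/-- The partial derivative `∂_i` on `P_n`. -/
noncomputable def opD (i : Fin n) : EndP K n := (MvPolynomial.pderiv i).toLinearMap

/-- The integration `∫_i : x^α ↦ (α_i + 1)⁻¹ x_i x^α` on `P_n`. -/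
noncomputable def opInt (i : Fin n) : EndP K n :=
  (MvPolynomial.basisMonomials (Fin n) K).constr K fun α =>
    MvPolynomial.monomial (α + Finsupp.single i 1) ((α i + 1 : K)⁻¹)

variable (n)

/-- The algebra `K⟨x_i, ∂_i, ∫_i | i = 1, …, n⟩ ⊆ End_K(P_n)` of polynomial integro-differential
operators, as a subalgebra. -/
noncomputable def polyIntDiff : Subalgebra K (EndP K n) :=
  Algebra.adjoin K (Set.range (opX K) ∪ Set.range (opD K) ∪ Set.range (opInt K))

/-- The algebra `𝕀_n` of polynomial integro-differential operators. -/
def II : Type _ := polyIntDiff K n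

noncomputable instance : Ring (II K n) := inferInstanceAs (Ring (polyIntDiff K n))

noncomputable instance : Algebra K (II K n) := inferInstanceAs (Algebra K (polyIntDiff K n))

instance : Nontrivial (II K n) := inferInstanceAs (Nontrivial (polyIntDiff K n))

variable {n}

/-- `x_i ∈ 𝕀_n`. -/
noncomputable def x (i : Fin n) : II K n :=
  (⟨opX K i, Algebra.subset_adjoin (Or.inl (Or.inl ⟨i, rfl⟩))⟩ : polyIntDiff K n)

/-- `∂_i ∈ 𝕀_n`. -/
noncomputable def d (i : Fin n) : II K n :=
  (⟨opD K i, Algebra.subset_adjoin (Or.inl (Or.inr ⟨i, rfl⟩))⟩ : polyIntDiff K n)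

/-- `∫_i ∈ 𝕀_n`. -/
noncomputable def int (i : Fin n) : II K n :=
  (⟨opInt K i, Algebra.subset_adjoin (Or.inr ⟨i, rfl⟩)⟩ : polyIntDiff K n)

/-- `H_i = ∂_i x_i`. -/
noncomputable def H (i : Fin n) : II K n := d K i * x K i

/-- `∂^α = ∂_1^{α_1} ⋯ ∂_n^{α_n}`. -/
noncomputable def dPow (α : Fin n → ℕ) : II K n := (List.ofFn fun i => d K i ^ α i).prod

/-- The matrix units `e_{st}(i) = ∫_i^s ∂_i^t - ∫_i^{s+1} ∂_i^{t+1}`. -/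
noncomputable def e (i : Fin n) (s t : ℕ) : II K n :=
  int K i ^ s * d K i ^ t - int K i ^ (s + 1) * d K i ^ (t + 1)

/-- The ideal `𝔭_i = 𝕀_1 ⊗ ⋯ ⊗ F ⊗ ⋯ ⊗ 𝕀_1` of `𝕀_n` (with `F = ⊕ K e_{st}` in the `i`-th place),
i.e. the two-sided ideal generated by the elements `e_{st}(i)`. -/
noncomputable def primeP (i : Fin n) : TwoSidedIdeal (II K n) :=
  TwoSidedIdeal.span (Set.range fun p : ℕ × ℕ => e K i p.1 p.2)

variable (n)

/-- The ideal `𝔞_n = 𝔭_1 + ⋯ + 𝔭_n` of `𝕀_n`. -/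
noncomputable def idealA : Ideal (II K n) :=
  TwoSidedIdeal.asIdeal (⨆ i : Fin n, primeP K i)

instance : (idealA K n).IsTwoSided := by
  unfold idealA; infer_instance

/-- The projection `π : 𝕀_n → 𝕀_n/𝔞_n`. -/
noncomputable abbrev proj : II K n →+* II K n ⧸ idealA K n := Ideal.Quotient.mk (idealA K n)

/-- The subalgebra `Δ_n = K⟨H_1, …, H_n, ∂_1, …, ∂_n⟩` of `𝕀_n` (the skew polynomial ring
`K[H_1, …, H_n][∂_1, …, ∂_n; τ_1, …, τ_n]`, `τ_i(H_i) = H_i + 1`). -/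
noncomputable def Delta : Subalgebra K (II K n) :=
  Algebra.adjoin K (Set.range (H K) ∪ Set.range (d K))

/-- `'Δ_n = Δ_n ∩ 'S(𝕀_n)`. -/
def lDelta : Set (II K n) := (Delta K n : Set (II K n)) ∩ largestLeftRegDen (II K n)

/-- The saturation of `'Δ_n`: the set of all `c ∈ Δ_n` such that `∂^α c ∈ 'S(𝕀_n)` for some
`α ∈ ℕ^n`. -/
def satDelta : Set (II K n) :=
  {c ∈ (Delta K n : Set (II K n)) | ∃ α : Fin n → ℕ, dPow K α * c ∈ largestLeftRegDen (II K n)}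

/-- `'S(𝕀_n) ∩ ('C_{Δ_n + 𝔞_n} + 𝔞_n)`. -/
def llDeltaCore : Set (II K n) :=
  largestLeftRegDen (II K n) ∩
    (leftRegularOf ((Delta K n : Set (II K n)) + (idealA K n : Set (II K n))) +
      (idealA K n : Set (II K n)))

/-- `''Δ_n = 'S(𝕀_n) ∩ ('C_{Δ_n + 𝔞_n} + 𝔞_n) + 𝔞_n`. -/
def llDelta : Set (II K n) := llDeltaCore K n + (idealA K n : Set (II K n))

/-- `S ∈ Den_l(𝕀_n, 𝔞_n)` and `S⁻¹𝕀_n ≃ 'Q(𝕀_n)` (an `𝕀_n`-isomorphism). -/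
def LocalizesToQuot (S : Set (II K n)) : Prop :=
  ∃ h : IsLeftDenominatorSetWith S (idealA K n),
    IsoOver h.toIsLeftDenominatorSet.toLoc (toLeftRegQuot (II K n))

/-- `S ∈ Den_l(𝕀_n/𝔞_n, 0)` and `S⁻¹(𝕀_n/𝔞_n) ≃ 'Q(𝕀_n)` (an `𝕀_n`-isomorphism). -/
def FactorLocalizesToQuot (S : Set (II K n ⧸ idealA K n)) : Prop :=
  ∃ h : IsLeftDenominatorSetWith S ⊥,
    IsoOver (h.toIsLeftDenominatorSet.toLoc.comp (proj K n)) (toLeftRegQuot (II K n))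

end Operators

end IntDiff

/-!
Write `φ : 𝕀_n → 'Q(𝕀_n)` for the canonical homomorphism.  All seven parts rest on one criterion
(`IsLeftLocalization`): if `S` is closed under products, `φ` maps `S` to units, every element of
the target is a left fraction with denominator in `S`, and each element of the kernel of `φ` is
annihilated from the left by an element of `S`, then `S` is a left denominator set and `φ` is the
localization at `S`.  Enlarging `S` by elements that are units under `φ` preserves these
conditions, as long as `S` stays closed under products (`IsLeftLocalization.mono`).  Hence
`'S(𝕀_n)` consists of the left regular elements that are units under `φ`
(`mem_largestLeftRegDen_iff`), and it remains to treat the smallest set `'Δ_n`, to check that the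
larger sets are closed under products, and to determine the kernel of `φ`.

The link between `𝕀_n` and `Δ_n` is given by the elements `∂^α`.  Since `∂_i ∫_i = 1` and
`∂_i x_i = H_i`, each `r ∈ 𝕀_n` satisfies `∂^α r ∈ Δ_n` for some `α`
(`exists_dPow_mul_mem_Delta`); since also `∂^α Δ_n ⊆ Δ_n ∂^α` and `∂^α` is left regular, the set
of all `∂^α` is a left denominator set, and it is contained in `'S(𝕀_n)`
(`dPow_mem_largestLeftRegDen`).  So numerators and denominators of left fractions can be moved
into `Δ_n`, and the criterion holds for `'Δ_n`.

The kernel of `φ` is `𝔞_n` (`toLeftRegQuot_eq_zero_iff`).  It contains `𝔞_n`, because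
`∂_i^{s+1}` annihilates the matrix unit `e_{st}(i)` and becomes a unit.  Conversely, `Δ_n` has no
zero divisors (`eq_zero_of_mul_eq_zero`), so `φ` is injective on `Δ_n`; if `φ r = 0`, then
`∂^α r ∈ Δ_n` is zero for some `α`, and `r ∈ 𝔞_n` because `∂^α` is invertible modulo `𝔞_n`.  That
`Δ_n` has no zero divisors is seen on monomials: an element of `Δ_n` acts by
`x^γ ↦ ∑ f_α(γ) x^{γ - α}` with polynomials `f_α`, and for a pair of exponents whose sum is unique
the corresponding coefficient of a product is a product of two nonzero polynomials, up to a shift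
of the variables.

The saturation of `'Δ_n` is closed under products because, in a relation `∂^β c = c' ∂^β` with a
left regular element `c`, the element `c'` is left regular as well.
-/

namespace IntDiff

/-! ### Recognizing left localizations -/

section General

variable {R : Type*} [Ring R]

theorem mul_mem_leftRegular {c c' : R} (hc : c ∈ leftRegular R) (hc' : c' ∈ leftRegular R) :
    c * c' ∈ leftRegular R :=
  fun r hr => hc r (hc' _ (by rw [mul_assoc, hr]))

theorem one_mem_leftRegular : (1 : R) ∈ leftRegular R := fun r hr => by simpa using hr

theorem mem_leftRegular_of_mul {u v : R} (h : u * v ∈ leftRegular R) : u ∈ leftRegular R :=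
  fun r hr => h r (by rw [← mul_assoc, hr, zero_mul])

theorem mem_leftRegular_of_mul_eq_one {u v : R} (h : u * v = 1) : u ∈ leftRegular R :=
  mem_leftRegular_of_mul (h ▸ one_mem_leftRegular)

theorem zero_notMem_leftRegular [Nontrivial R] : (0 : R) ∉ leftRegular R :=
  fun h => one_ne_zero (h 1 (mul_zero 1))

/-- The conditions that characterize `φ : R → Q` as a left localization of `R` at `S`. The third
one says that `Q` consists of left fractions with denominators from `S`. -/
structure IsLeftLocalization {Q : Type*} [Ring Q] (φ : R →+* Q) (S : Set R) : Prop where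
  one_mem : (1 : R) ∈ S
  mul_mem : ∀ s ∈ S, ∀ t ∈ S, s * t ∈ S
  isUnit : ∀ s ∈ S, IsUnit (φ s)
  exists_mul_eq : ∀ q : Q, ∃ s ∈ S, ∃ r : R, φ s * q = φ r
  exists_mul_eq_zero : ∀ r : R, φ r = 0 → ∃ s ∈ S, s * r = 0

namespace IsLeftLocalization

variable {Q : Type*} [Ring Q] {φ : R →+* Q} {S : Set R}

theorem leftAss_eq (h : IsLeftLocalization φ S) : leftAss S = {r | φ r = 0} := by
  ext r
  refine ⟨fun ⟨s, hs, e⟩ => ?_, fun hr => h.exists_mul_eq_zero r hr⟩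
  have := congrArg φ e
  rw [map_mul, map_zero] at this
  exact (h.isUnit s hs).mul_right_eq_zero.mp this

theorem isLeftDenominatorSet [Nontrivial Q] (h : IsLeftLocalization φ S) :
    IsLeftDenominatorSet S where
  one_mem := h.one_mem
  mul_mem := h.mul_mem
  zero_notMem h0 := by
    have := h.isUnit 0 h0
    rw [map_zero] at this
    exact not_isUnit_zero this
  ore r s hs := by
    -- write `φ r * (φ s)⁻¹` as a left fraction and clear the kernel of `φ`
    obtain ⟨u, hu⟩ := h.isUnit s hs
    obtain ⟨t, ht, r₁, e⟩ := h.exists_mul_eq (φ r * (u⁻¹ : Qˣ))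
    have e' : φ (t * r - r₁ * s) = 0 := by
      rw [map_sub, map_mul, map_mul, ← e, ← hu, mul_assoc, mul_assoc, Units.inv_mul, mul_one,
        sub_self]
    obtain ⟨t', ht', e''⟩ := h.exists_mul_eq_zero _ e'
    refine ⟨t' * t, h.mul_mem _ ht' _ ht, t' * r₁, ?_⟩
    rwa [mul_sub, sub_eq_zero, ← mul_assoc, ← mul_assoc] at e''
  mem_leftAss r s hs e := by
    rw [h.leftAss_eq]
    have := congrArg φ e
    rw [map_mul, map_zero] at this
    exact (h.isUnit s hs).mul_left_eq_zero.mp this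

theorem isoOver [Nontrivial Q] (h : IsLeftLocalization φ S) (hS : IsLeftDenominatorSet S) :
    IsoOver hS.toLoc φ := by
  let fS : hS.submonoid →* Qˣ := IsUnit.liftRight ((φ : R →* Q).comp hS.submonoid.subtype)
    fun s => h.isUnit s s.2
  have hf : ∀ s : hS.submonoid, φ s = fS s := fun s => rfl
  let F : hS.Loc →+* Q := OreLocalization.universalHom φ fS hf
  have hF : ∀ r (s : hS.submonoid), F (OreLocalization.oreDiv r s) = ((fS s)⁻¹ : Qˣ) * φ r :=
    fun r s => OreLocalization.universalHom_apply φ fS hf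
  have inj : Function.Injective F := by
    rw [injective_iff_map_eq_zero]
    intro x
    induction x using OreLocalization.ind with | _ r s
    intro hx
    rw [hF, Units.mul_right_eq_zero] at hx
    obtain ⟨t, ht, e⟩ := h.exists_mul_eq_zero r hx
    rw [← OreLocalization.zero_oreDiv' s, OreLocalization.oreDiv_eq_iff]
    refine ⟨⟨t, ht⟩, t, ?_, rfl⟩
    rw [smul_zero, smul_eq_mul, e]
  have surj : Function.Surjective F := by
    intro q
    obtain ⟨s, hs, r, e⟩ := h.exists_mul_eq q
    refine ⟨OreLocalization.oreDiv r (⟨s, hs⟩ : hS.submonoid), ?_⟩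
    rw [hF, ← e, Units.inv_mul_eq_iff_eq_mul, ← hf]
  exact ⟨RingEquiv.ofBijective F ⟨inj, surj⟩, fun r =>
    OreLocalization.universalHom_commutes φ fS hf⟩

/-- Enlarging the set of denominators does not change the localization, as long as the new
denominators are invertible there. -/
theorem mono (h : IsLeftLocalization φ S) {T : Set R} (hST : S ⊆ T)
    (mul : ∀ s ∈ T, ∀ t ∈ T, s * t ∈ T) (unit : ∀ s ∈ T, IsUnit (φ s)) :
    IsLeftLocalization φ T where
  one_mem := hST h.one_mem
  mul_mem := mul
  isUnit := unit
  exists_mul_eq q :=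
    let ⟨s, hs, r⟩ := h.exists_mul_eq q
    ⟨s, hST hs, r⟩
  exists_mul_eq_zero r hr :=
    let ⟨s, hs, e⟩ := h.exists_mul_eq_zero r hr
    ⟨s, hST hs, e⟩

theorem add_ideal (h : IsLeftLocalization φ S) (𝔞 : Ideal R) [𝔞.IsTwoSided]
    (h𝔞 : ∀ a ∈ 𝔞, φ a = 0) : IsLeftLocalization φ (S + (𝔞 : Set R)) := by
  refine h.mono (fun s hs => ⟨s, hs, 0, 𝔞.zero_mem, add_zero s⟩) ?_ ?_
  · rintro _ ⟨s, hs, a, ha, rfl⟩ _ ⟨t, ht, b, hb, rfl⟩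
    refine ⟨s * t, h.mul_mem _ hs _ ht, s * b + a * (t + b),
      𝔞.add_mem (𝔞.mul_mem_left _ hb) (𝔞.mul_mem_right _ ha), ?_⟩
    change s * t + (s * b + a * (t + b)) = (s + a) * (t + b)
    noncomm_ring
  · rintro _ ⟨s, hs, a, ha, rfl⟩
    change IsUnit (φ (s + a))
    rw [map_add, h𝔞 a ha, add_zero]
    exact h.isUnit s hs

/-- If a localization factors as `ψ ∘ p` with `ψ` injective, then `ψ` is the localization at the
image of the set of denominators under `p`. -/
theorem image {R' : Type*} [Ring R'] {p : R →+* R'} {ψ : R' →+* Q}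
    (h : IsLeftLocalization (ψ.comp p) S) (hψ : Function.Injective ψ) : IsLeftLocalization ψ (p '' S) where
  one_mem := ⟨1, h.one_mem, map_one p⟩
  mul_mem := by
    rintro _ ⟨s, hs, rfl⟩ _ ⟨t, ht, rfl⟩
    exact ⟨s * t, h.mul_mem _ hs _ ht, map_mul p s t⟩
  isUnit := by
    rintro _ ⟨s, hs, rfl⟩
    exact h.isUnit s hs
  exists_mul_eq q :=
    let ⟨s, hs, r, e⟩ := h.exists_mul_eq q
    ⟨p s, ⟨s, hs, rfl⟩, p r, e⟩
  exists_mul_eq_zero r hr :=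
    ⟨1, ⟨1, h.one_mem, map_one p⟩, by
      rw [(injective_iff_map_eq_zero ψ).mp hψ r hr, mul_zero]⟩

end IsLeftLocalization

theorem IsLeftDenominatorSet.isLeftLocalization {S : Set R} (h : IsLeftDenominatorSet S) :
    IsLeftLocalization h.toLoc S where
  one_mem := h.one_mem
  mul_mem := h.mul_mem
  isUnit s hs := OreLocalization.numerator_isUnit (⟨s, hs⟩ : h.submonoid)
  exists_mul_eq q := by
    induction q using OreLocalization.ind with | _ r s
    refine ⟨s, s.2, r, ?_⟩
    change OreLocalization.oreDiv (s : R) (1 : h.submonoid) * OreLocalization.oreDiv r s =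
      OreLocalization.oreDiv r 1
    exact OreLocalization.mul_cancel
  exists_mul_eq_zero r hr := by
    change OreLocalization.oreDiv r (1 : h.submonoid) = 0 at hr
    rw [OreLocalization.zero_def, eq_comm, OreLocalization.oreDiv_eq_iff] at hr
    obtain ⟨u, v, e, -⟩ := hr
    rw [smul_zero] at e
    exact ⟨u, u.2, e⟩

section LeftRegQuot

variable [Nontrivial R]

theorem isLeftLocalization_toLeftRegQuot :
    IsLeftLocalization (toLeftRegQuot R) (largestLeftRegDen R) :=
  (isGreatest_largestLeftRegDen R).1.1.isLeftLocalization

theorem largestLeftRegDen_subset_leftRegular : largestLeftRegDen R ⊆ leftRegular R :=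
  (isGreatest_largestLeftRegDen R).1.2

instance : Nontrivial (LeftRegQuot R) :=
  OreLocalization.nontrivial_iff.mpr (isGreatest_largestLeftRegDen R).1.1.zero_notMem

/-- The set `'S(R)` consists of the left regular elements that become units in `'Q(R)`: these
elements form a left denominator set. -/
theorem mem_largestLeftRegDen_iff {c : R} :
    c ∈ largestLeftRegDen R ↔ c ∈ leftRegular R ∧ IsUnit (toLeftRegQuot R c) := by
  refine ⟨fun hc => ⟨largestLeftRegDen_subset_leftRegular hc,
    isLeftLocalization_toLeftRegQuot.isUnit c hc⟩, fun hc => ?_⟩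
  have h : IsLeftLocalization (toLeftRegQuot R)
      {c : R | c ∈ leftRegular R ∧ IsUnit (toLeftRegQuot R c)} := by
    refine isLeftLocalization_toLeftRegQuot.mono
      (fun c hc => ⟨largestLeftRegDen_subset_leftRegular hc,
        isLeftLocalization_toLeftRegQuot.isUnit c hc⟩) (fun s hs t ht => ?_) fun s hs => hs.2
    exact ⟨mul_mem_leftRegular hs.1 ht.1, by rw [map_mul]; exact hs.2.mul ht.2⟩
  exact (isGreatest_largestLeftRegDen R).2 ⟨h.isLeftDenominatorSet, fun c hc => hc.1⟩ hc

end LeftRegQuot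

end General

/-! ### Relations between the generators of `𝕀_n` -/

/-- Powers of a commuting family multiply exponentwise. -/
theorem prod_ofFn_pow_add {M : Type*} [Monoid M] {m : ℕ} (f : Fin m → M)
    (hf : ∀ i j, Commute (f i) (f j)) (α β : Fin m → ℕ) :
    (List.ofFn fun i => f i ^ (α i + β i)).prod =
      (List.ofFn fun i => f i ^ α i).prod * (List.ofFn fun i => f i ^ β i).prod := by
  induction m with
  | zero => simp
  | succ m ih =>
    simp only [List.ofFn_succ, List.prod_cons]
    rw [ih (fun i => f i.succ) (fun i j => hf _ _) (fun i => α i.succ) fun i => β i.succ, pow_add]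
    have hc : Commute (f 0 ^ β 0) (List.ofFn fun i => f (Fin.succ i) ^ α (Fin.succ i)).prod := by
      refine Commute.list_prod_right _ _ fun y hy => ?_
      obtain ⟨i, rfl⟩ := List.mem_ofFn.mp hy
      exact (hf _ _).pow_pow _ _
    simp only [mul_assoc]
    rw [← mul_assoc (f 0 ^ β 0), hc.eq, mul_assoc]

theorem prod_ofFn_pow_single {M : Type*} [Monoid M] {m : ℕ} (f : Fin m → M) (i : Fin m) :
    (List.ofFn fun j => f j ^ (Pi.single i 1 : Fin m → ℕ) j).prod = f i := by
  induction m with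
  | zero => exact i.elim0
  | succ m ih =>
    simp only [List.ofFn_succ, List.prod_cons]
    induction i using Fin.cases with
    | zero => simp [Fin.succ_ne_zero]
    | succ i =>
      have := ih (fun j => f j.succ) i
      simp only [Pi.single_apply, Fin.succ_inj] at this ⊢
      rw [this, if_neg (Fin.succ_ne_zero i).symm, pow_zero, one_mul]

section Operators

variable {K : Type*} [Field K] {n : ℕ}

variable (K n) in
/-- The inclusion of `𝕀_n` into `End_K(P_n)`. -/
noncomputable def toEnd : II K n →ₐ[K] EndP K n := (polyIntDiff K n).val

theorem toEnd_injective : Function.Injective (toEnd K n) := Subtype.val_injective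

theorem toEnd_x (i : Fin n) : toEnd K n (x K i) = opX K i := rfl

theorem toEnd_d (i : Fin n) : toEnd K n (d K i) = opD K i := rfl

theorem toEnd_int (i : Fin n) : toEnd K n (int K i) = opInt K i := rfl

theorem II.induction {p : II K n → Prop} (hx : ∀ i, p (x K i)) (hd : ∀ i, p (d K i))
    (hint : ∀ i, p (int K i)) (algebraMap : ∀ k, p (algebraMap K (II K n) k))
    (add : ∀ r s, p r → p s → p (r + s)) (mul : ∀ r s, p r → p s → p (r * s)) (r : II K n) :
    p r := by
  obtain ⟨r, hr⟩ := r
  change Algebra.adjoin K _ |>.carrier r at hr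
  refine Algebra.adjoin_induction (p := fun r hr => p (⟨r, hr⟩ : polyIntDiff K n)) ?_ ?_ ?_ ?_ hr
  · rintro _ ((⟨i, rfl⟩ | ⟨i, rfl⟩) | ⟨i, rfl⟩)
    exacts [hx i, hd i, hint i]
  · exact algebraMap
  · exact fun r s _ _ => add _ _
  · exact fun r s _ _ => mul _ _

theorem d_mul_d (i j : Fin n) : d K i * d K j = d K j * d K i := by
  apply toEnd_injective
  simp only [map_mul, toEnd_d]
  have h : ⁅(MvPolynomial.pderiv i : Derivation K (MvPolynomial (Fin n) K) _),
      (MvPolynomial.pderiv j : Derivation K (MvPolynomial (Fin n) K) _)⁆ = 0 :=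
    MvPolynomial.derivation_ext fun k => by
      rw [Derivation.commutator_apply]
      simp [MvPolynomial.pderiv_X, Pi.single_apply, apply_ite]
  refine LinearMap.ext fun f => sub_eq_zero.mp ?_
  have hf := DFunLike.congr_fun h f
  rw [Derivation.commutator_apply] at hf
  exact hf

theorem d_mul_x (i j : Fin n) :
    d K i * x K j = x K j * d K i + algebraMap K (II K n) (if i = j then 1 else 0) := by
  apply toEnd_injective
  simp only [map_mul, map_add, toEnd_d, toEnd_x, AlgHom.commutes]
  refine LinearMap.ext fun f => ?_
  simp [opD, opX, MvPolynomial.pderiv_X, Pi.single_apply]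
  obtain rfl | h := eq_or_ne j i
  · simp
  · simp [h, h.symm]

theorem d_mul_int [CharZero K] (i : Fin n) : d K i * int K i = 1 := by
  apply toEnd_injective
  simp only [map_mul, map_one, toEnd_d, toEnd_int]
  refine (MvPolynomial.basisMonomials (Fin n) K).ext fun γ => ?_
  have h : (γ i + 1 : K) ≠ 0 := by exact_mod_cast Nat.succ_ne_zero (γ i)
  rw [Module.End.mul_apply, opInt, Module.Basis.constr_basis]
  simp [opD, MvPolynomial.pderiv_monomial, h]

theorem d_mul_H (i j : Fin n) :
    d K i * H K j = (H K j + algebraMap K (II K n) (if i = j then 1 else 0)) * d K i := by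
  rw [H, ← mul_assoc, d_mul_d i j, mul_assoc, d_mul_x, mul_add, add_mul, ← mul_assoc,
    ← Algebra.commutes]
  split_ifs with h <;> simp [h]

/-! ### The powers `∂^α` -/

theorem dPow_add (α β : Fin n → ℕ) : dPow K (α + β) = dPow K α * dPow K β :=
  prod_ofFn_pow_add _ (fun i j => d_mul_d i j) α β

theorem dPow_single (i : Fin n) : dPow K (Pi.single i 1) = d K i := prod_ofFn_pow_single _ i

theorem dPow_zero : dPow K (0 : Fin n → ℕ) = 1 := by
  simp [dPow]

theorem dPow_induction {p : II K n → Prop} (one : p 1)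
    (mul : ∀ i (α : Fin n → ℕ), p (dPow K α) → p (d K i * dPow K α)) (α : Fin n → ℕ) :
    p (dPow K α) := by
  induction hm : ∑ i, α i generalizing α with
  | zero =>
    have : α = 0 := funext fun i => Finset.sum_eq_zero_iff.mp hm i (Finset.mem_univ i)
    rwa [this, dPow_zero]
  | succ m ih =>
    obtain ⟨i, -, hi⟩ := Finset.exists_ne_zero_of_sum_ne_zero (hm.trans_ne m.succ_ne_zero)
    have e : α = Pi.single i 1 + (α - Pi.single i 1) := by
      refine (add_tsub_cancel_of_le fun j => ?_).symm
      obtain rfl | hj := eq_or_ne j i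
      · rw [Pi.single_eq_same]
        exact Nat.one_le_iff_ne_zero.mpr hi
      · rw [Pi.single_eq_of_ne hj]
        exact Nat.zero_le _
    rw [e] at hm ⊢
    rw [dPow_add, dPow_single]
    refine mul i _ (ih _ ?_)
    simp only [Pi.add_apply, Finset.sum_add_distrib, Finset.sum_pi_single', Finset.mem_univ,
      if_true] at hm
    omega

theorem H_mem_Delta (i : Fin n) : H K i ∈ Delta K n := Algebra.subset_adjoin (Or.inl ⟨i, rfl⟩)

theorem d_mem_Delta (i : Fin n) : d K i ∈ Delta K n := Algebra.subset_adjoin (Or.inr ⟨i, rfl⟩)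

theorem dPow_mem_Delta (α : Fin n → ℕ) : dPow K α ∈ Delta K n :=
  dPow_induction (one_mem _) (fun i _ h => mul_mem (d_mem_Delta i) h) α

/-- The elements `∂^α` are left regular, as `∂_i ∫_i = 1`. -/
theorem dPow_mem_leftRegular [CharZero K] (α : Fin n → ℕ) : dPow K α ∈ leftRegular (II K n) :=
  dPow_induction one_mem_leftRegular
    (fun i _ h => mul_mem_leftRegular (mem_leftRegular_of_mul_eq_one (d_mul_int i)) h) α

theorem exists_d_mul_eq (i : Fin n) {c : II K n} (hc : c ∈ Delta K n) :
    ∃ c' ∈ Delta K n, d K i * c = c' * d K i := by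
  induction hc using Algebra.adjoin_induction with
  | mem c hc =>
    obtain ⟨j, rfl⟩ | ⟨j, rfl⟩ := hc
    · exact ⟨_, add_mem (H_mem_Delta j) (Subalgebra.algebraMap_mem _ _), d_mul_H i j⟩
    · exact ⟨_, d_mem_Delta j, d_mul_d i j⟩
  | algebraMap k => exact ⟨_, Subalgebra.algebraMap_mem _ k, (Algebra.commutes k _).symm⟩
  | add c₁ c₂ _ _ h₁ h₂ =>
    obtain ⟨c₁', m₁, e₁⟩ := h₁
    obtain ⟨c₂', m₂, e₂⟩ := h₂
    exact ⟨_, add_mem m₁ m₂, by rw [mul_add, e₁, e₂, add_mul]⟩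
  | mul c₁ c₂ _ _ h₁ h₂ =>
    obtain ⟨c₁', m₁, e₁⟩ := h₁
    obtain ⟨c₂', m₂, e₂⟩ := h₂
    exact ⟨_, mul_mem m₁ m₂, by rw [← mul_assoc, e₁, mul_assoc, e₂, mul_assoc]⟩

/-- The inclusion `∂^α Δ_n ⊆ Δ_n ∂^α`. -/
theorem exists_dPow_mul_eq (α : Fin n → ℕ) {c : II K n} (hc : c ∈ Delta K n) :
    ∃ c' ∈ Delta K n, dPow K α * c = c' * dPow K α := by
  refine dPow_induction (p := fun y => ∃ c' ∈ Delta K n, y * c = c' * y)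
    ⟨c, hc, by rw [one_mul, mul_one]⟩ ?_ α
  rintro i α ⟨c', hc', e⟩
  obtain ⟨c'', hc'', e'⟩ := exists_d_mul_eq i hc'
  exact ⟨c'', hc'', by rw [mul_assoc, e, ← mul_assoc, e', mul_assoc]⟩

/-- Every element of `𝕀_n` is moved into `Δ_n` by some `∂^α`: the integrations are cancelled by
`∂_i ∫_i = 1`, and `∂_i x_i = H_i`. -/
theorem exists_dPow_mul_mem_Delta [CharZero K] (r : II K n) :
    ∃ α : Fin n → ℕ, dPow K α * r ∈ Delta K n := by
  induction r using II.induction with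
  | hx i => exact ⟨Pi.single i 1, by rw [dPow_single]; exact H_mem_Delta i⟩
  | hd i => exact ⟨0, by rw [dPow_zero, one_mul]; exact d_mem_Delta i⟩
  | hint i => exact ⟨Pi.single i 1, by rw [dPow_single, d_mul_int]; exact one_mem _⟩
  | algebraMap k => exact ⟨0, by rw [dPow_zero, one_mul]; exact Subalgebra.algebraMap_mem _ k⟩
  | add r s hr hs =>
    obtain ⟨α, hα⟩ := hr
    obtain ⟨β, hβ⟩ := hs
    refine ⟨α + β, ?_⟩
    rw [mul_add]
    refine add_mem ?_ ?_
    · rw [add_comm, dPow_add, mul_assoc]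
      exact mul_mem (dPow_mem_Delta _) hα
    · rw [dPow_add, mul_assoc]
      exact mul_mem (dPow_mem_Delta _) hβ
  | mul r s hr hs =>
    obtain ⟨α, hα⟩ := hr
    obtain ⟨β, hβ⟩ := hs
    obtain ⟨c, hc, e⟩ := exists_dPow_mul_eq β hα
    refine ⟨β + α, ?_⟩
    rw [dPow_add, ← mul_assoc, mul_assoc (dPow K β), e, mul_assoc]
    exact mul_mem hc hβ

/-- The set `{∂^α}` is a left denominator set, and it is contained in `'S(𝕀_n)`. -/
theorem dPow_mem_largestLeftRegDen [CharZero K] (α : Fin n → ℕ) :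
    dPow K α ∈ largestLeftRegDen (II K n) := by
  refine Set.mem_sUnion.mpr ⟨Set.range (dPow K), ⟨?_, ?_⟩, α, rfl⟩
  · refine ⟨⟨⟨⟨0, dPow_zero⟩, ?_, ?_⟩, ?_⟩, ?_⟩
    · rintro _ ⟨α, rfl⟩ _ ⟨β, rfl⟩
      exact ⟨α + β, dPow_add α β⟩
    · rintro ⟨α, e⟩
      exact zero_notMem_leftRegular (e ▸ dPow_mem_leftRegular α)
    · rintro r _ ⟨α, rfl⟩
      obtain ⟨β, hβ⟩ := exists_dPow_mul_mem_Delta r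
      obtain ⟨c, -, e⟩ := exists_dPow_mul_eq α hβ
      exact ⟨_, ⟨α + β, rfl⟩, c, by rw [dPow_add, mul_assoc, e]⟩
    · rintro r _ ⟨α, rfl⟩ e
      exact ⟨1, ⟨0, dPow_zero⟩, by rw [dPow_mem_leftRegular α r e, mul_zero]⟩
  · rintro _ ⟨α, rfl⟩
    exact dPow_mem_leftRegular α

end Operators

/-! ### `Δ_n` has no zero divisors -/

section Operators

variable {K : Type*} [Field K] {n : ℕ}

open MvPolynomial in
/-- The operator `T` acts on monomials by `x^γ ↦ ∑ f_α(γ) x^{γ - α}`, where the sum is over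
`α ≤ γ` and the `f_α` are finitely many polynomials. -/
def HasExpansion (T : EndP K n) (f : (Fin n →₀ ℕ) →₀ MvPolynomial (Fin n) K) : Prop :=
  ∀ γ : Fin n →₀ ℕ, T (monomial γ 1) = f.sum fun α p =>
    if α ≤ γ then monomial (γ - α) (eval (fun i => (γ i : K)) p) else 0

open MvPolynomial in
theorem eval_aeval_X_add_C (p : MvPolynomial (Fin n) K) (y z : Fin n → K) :
    eval y (aeval (fun i => X i + C (z i)) p) = eval (fun i => y i + z i) p := by
  rw [← coe_aeval_eq_eval, RingHom.coe_coe, ← coe_aeval_eq_eval, RingHom.coe_coe,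
    comp_aeval_apply]
  simp

namespace HasExpansion

open MvPolynomial

variable {T T' : EndP K n} {f g : (Fin n →₀ ℕ) →₀ MvPolynomial (Fin n) K}

theorem apply_monomial (h : HasExpansion T f) (γ : Fin n →₀ ℕ) (c : K) :
    T (monomial γ c) = f.sum fun α p =>
      if α ≤ γ then monomial (γ - α) (c * eval (fun i => (γ i : K)) p) else 0 := by
  have e : monomial γ c = c • monomial γ (1 : K) := by rw [smul_monomial, smul_eq_mul, mul_one]
  rw [e, map_smul, h γ, Finsupp.smul_sum]
  refine Finsupp.sum_congr fun α _ => ?_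
  rw [smul_ite, smul_zero, smul_monomial, smul_eq_mul]

theorem eq_zero (h : HasExpansion T 0) : T = 0 :=
  (basisMonomials (Fin n) K).ext fun γ => by
    rw [coe_basisMonomials, h γ, Finsupp.sum_zero_index, LinearMap.zero_apply]

theorem zero : HasExpansion (0 : EndP K n) 0 := fun γ => by
  rw [LinearMap.zero_apply, Finsupp.sum_zero_index]

theorem add (h : HasExpansion T f) (h' : HasExpansion T' g) : HasExpansion (T + T') (f + g) := by
  intro γ
  rw [LinearMap.add_apply, h γ, h' γ, Finsupp.sum_add_index']
  · intro α
    simp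
  · intro α p q
    split_ifs <;> simp

theorem smul (k : K) (h : HasExpansion T f) : HasExpansion (k • T) (k • f) := by
  intro γ
  rw [LinearMap.smul_apply, h γ, Finsupp.sum_smul_index', Finsupp.smul_sum]
  · refine Finsupp.sum_congr fun α _ => ?_
    split_ifs <;> simp [smul_monomial]
  · intro α
    simp

theorem single_iff {α : Fin n →₀ ℕ} {p : MvPolynomial (Fin n) K} :
    HasExpansion T (Finsupp.single α p) ↔ ∀ γ : Fin n →₀ ℕ, T (monomial γ 1) =
      if α ≤ γ then monomial (γ - α) (eval (fun i => (γ i : K)) p) else 0 := by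
  refine forall_congr' fun γ => ?_
  rw [Finsupp.sum_single_index]
  simp

theorem one : HasExpansion (1 : EndP K n) (Finsupp.single 0 1) :=
  single_iff.mpr fun γ => by simp

theorem opD (i : Fin n) : HasExpansion (opD K i) (Finsupp.single (Finsupp.single i 1) (X i)) :=
  single_iff.mpr fun γ => by
    simp only [IntDiff.opD, Derivation.coeFn_coe, pderiv_monomial, one_mul, eval_X]
    split_ifs with h
    · rfl
    · rw [Finsupp.single_le_iff, Nat.one_le_iff_ne_zero, not_not] at h
      rw [h, Nat.cast_zero, map_zero]

theorem opD_mul_opX (i : Fin n) :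
    HasExpansion (IntDiff.opD K i * opX K i) (Finsupp.single 0 (X i + 1)) :=
  single_iff.mpr fun γ => by
    have h : opX K i (monomial γ 1) = monomial (Finsupp.single i 1 + γ) 1 := by
      rw [opX, LinearMap.mulLeft_apply, X, monomial_mul, one_mul]
    rw [Module.End.mul_apply, h]
    simp [IntDiff.opD, pderiv_monomial, add_comm]

theorem mul_single {α β : Fin n →₀ ℕ} {p q : MvPolynomial (Fin n) K}
    (h : HasExpansion T (Finsupp.single α p)) (h' : HasExpansion T' (Finsupp.single β q)) :
    HasExpansion (T * T') (Finsupp.single (α + β)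
      (q * aeval (fun i => X i + C (-(β i : K))) p)) := by
  refine single_iff.mpr fun γ => ?_
  rw [Module.End.mul_apply, single_iff.mp h' γ]
  by_cases hβ : β ≤ γ
  · rw [if_pos hβ, h.apply_monomial, Finsupp.sum_single_index (by simp)]
    refine if_congr (le_tsub_iff_right hβ) ?_ rfl
    rw [tsub_tsub, add_comm β α, RingHom.map_mul, eval_aeval_X_add_C]
    congr 4
    funext i
    rw [Finsupp.tsub_apply, Nat.cast_sub (hβ i), sub_eq_add_neg]
  · rw [if_neg hβ, map_zero, if_neg fun h => hβ (le_add_self.trans h)]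

end HasExpansion

theorem exists_hasExpansion {c : II K n} (hc : c ∈ Delta K n) :
    ∃ f, HasExpansion (toEnd K n c) f := by
  rw [Delta, ← Subalgebra.mem_toSubmodule, Algebra.adjoin_eq_span] at hc
  induction hc using Submodule.span_induction with
  | zero => exact ⟨0, by rw [map_zero]; exact .zero⟩
  | add c c' _ _ h h' =>
    obtain ⟨f, hf⟩ := h
    obtain ⟨g, hg⟩ := h'
    exact ⟨f + g, by rw [map_add]; exact hf.add hg⟩
  | smul k c _ h =>
    obtain ⟨f, hf⟩ := h
    exact ⟨k • f, by rw [map_smul]; exact hf.smul k⟩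
  | mem c hc =>
    suffices ∃ α p, HasExpansion (toEnd K n c) (Finsupp.single α p) from
      let ⟨_, _, h⟩ := this
      ⟨_, h⟩
    induction hc using Submonoid.closure_induction with
    | mem c hc =>
      obtain ⟨i, rfl⟩ | ⟨i, rfl⟩ := hc
      · exact ⟨_, _, HasExpansion.opD_mul_opX i⟩
      · exact ⟨_, _, HasExpansion.opD i⟩
    | one => exact ⟨_, _, by rw [map_one]; exact .one⟩
    | mul c c' _ _ h h' =>
      obtain ⟨α, p, hp⟩ := h
      obtain ⟨β, q, hq⟩ := h'
      exact ⟨_, _, by rw [map_mul]; exact hp.mul_single hq⟩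

open MvPolynomial in
/-- A nonzero polynomial is nonzero at some vector of arbitrarily large natural numbers. -/
theorem exists_le_eval_ne_zero [CharZero K] {p : MvPolynomial (Fin n) K} (hp : p ≠ 0)
    (α : Fin n →₀ ℕ) : ∃ δ : Fin n →₀ ℕ, α ≤ δ ∧ eval (fun i => (δ i : K)) p ≠ 0 := by
  by_contra! h
  refine hp (funext_set (fun i => (Nat.cast : ℕ → K) '' Set.Ici (α i))
    (fun i => (Set.Ici_infinite _).image Nat.cast_injective.injOn) fun y hy => ?_)
  choose δ hδ e using fun i => hy i (Set.mem_univ i)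
  have := h (Finsupp.equivFunOnFinite.symm δ) fun i => hδ i
  rw [map_zero, ← this]
  congr 2
  funext i
  exact (e i).symm

open MvPolynomial in
/-- For a pair of exponents `(α, β)` whose sum arises in only one way from the expansions of two
operators, the coefficient of `x^{γ - α - β}` in the image of `x^γ` under the composite is a value
of a product of two nonzero polynomials. -/
theorem HasExpansion.mul_ne_zero [CharZero K] {T T' : EndP K n}
    {f g : (Fin n →₀ ℕ) →₀ MvPolynomial (Fin n) K} (h : HasExpansion T f)
    (h' : HasExpansion T' g) (hf : f ≠ 0) (hg : g ≠ 0) : T * T' ≠ 0 := by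
  obtain ⟨α, hα, β, hβ, huniq⟩ := UniqueSums.uniqueAdd_of_nonempty
    (Finsupp.support_nonempty_iff.mpr hf) (Finsupp.support_nonempty_iff.mpr hg)
  let shift : MvPolynomial (Fin n) K →ₐ[K] MvPolynomial (Fin n) K :=
    aeval fun i => X i + C (β i : K)
  have eval_shift (y : Fin n → K) (p) : eval y (shift p) = eval (fun i => y i + (β i : K)) p :=
    eval_aeval_X_add_C p y _
  have hshift : shift (g β) ≠ 0 := fun h0 => by
    refine Finsupp.mem_support_iff.mp hβ (MvPolynomial.funext fun y => ?_)
    have := eval_shift (fun i => y i - (β i : K)) (g β)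
    simp only [h0, map_zero, sub_add_cancel] at this
    rw [map_zero, ← this]
  obtain ⟨δ, hδ, hne⟩ := exists_le_eval_ne_zero
    (_root_.mul_ne_zero (Finsupp.mem_support_iff.mp hα) hshift) α
  rw [map_mul, eval_shift] at hne
  intro h0
  apply hne
  have key := congrArg (coeff (δ - α)) (LinearMap.congr_fun h0 (monomial (δ + β) 1))
  rw [Module.End.mul_apply, h' (δ + β), Finsupp.sum, map_sum, coeff_sum,
    Finset.sum_eq_single_of_mem β hβ, if_pos le_add_self, add_tsub_cancel_right,
    h.apply_monomial, Finsupp.sum, coeff_sum, Finset.sum_eq_single_of_mem α hα, if_pos hδ,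
    coeff_monomial, if_pos rfl, mul_comm, LinearMap.zero_apply, coeff_zero] at key
  · simpa using key
  · intro α' hα' hne
    split_ifs with hle
    · rw [coeff_monomial, if_neg]
      intro e
      refine hne (huniq hα' hβ ?_).1
      rw [← tsub_tsub_cancel_of_le hle, e, tsub_tsub_cancel_of_le hδ]
    · rfl
  · intro β' hβ' hne
    split_ifs with hle
    · rw [h.apply_monomial, Finsupp.sum, coeff_sum]
      refine Finset.sum_eq_zero fun α' hα' => ?_
      split_ifs with hle'
      · rw [coeff_monomial, if_neg]
        intro e
        refine hne (huniq hα' hβ' ?_).2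
        ext i
        have h₁ := DFunLike.congr_fun e i
        have h₂ := hle i
        have h₃ := hle' i
        have h₄ := hδ i
        simp only [Finsupp.coe_tsub, Finsupp.coe_add, Pi.sub_apply, Pi.add_apply] at h₁ h₂ h₃ ⊢
        omega
      · rfl
    · rw [map_zero, coeff_zero]

theorem eq_zero_of_mul_eq_zero [CharZero K] {c c' : II K n} (hc : c ∈ Delta K n)
    (hc' : c' ∈ Delta K n) (h : c * c' = 0) (hne : c ≠ 0) : c' = 0 := by
  obtain ⟨f, hf⟩ := exists_hasExpansion hc
  obtain ⟨g, hg⟩ := exists_hasExpansion hc'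
  by_contra hne'
  refine hf.mul_ne_zero hg ?_ ?_ (by rw [← map_mul, h, map_zero])
  · rintro rfl
    exact hne (toEnd_injective (by rw [hf.eq_zero, map_zero]))
  · rintro rfl
    exact hne' (toEnd_injective (by rw [hg.eq_zero, map_zero]))

end Operators

/-! ### The kernel of `𝕀_n → 'Q(𝕀_n)` -/

section Operators

variable {K : Type*} [Field K] {n : ℕ}

theorem isUnit_toLeftRegQuot_dPow [CharZero K] (α : Fin n → ℕ) :
    IsUnit (toLeftRegQuot (II K n) (dPow K α)) :=
  isLeftLocalization_toLeftRegQuot.isUnit _ (dPow_mem_largestLeftRegDen α)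

theorem d_pow_mul_e [CharZero K] (i : Fin n) (s t : ℕ) : d K i ^ (s + 1) * e K i s t = 0 := by
  have h : ∀ m : ℕ, d K i ^ m * int K i ^ m = 1 := by
    intro m
    induction m with
    | zero => simp
    | succ m ih =>
      rw [pow_succ, pow_succ', mul_assoc, ← mul_assoc (d K i), d_mul_int, one_mul, ih]
  rw [e, mul_sub, ← mul_assoc, ← mul_assoc, h, one_mul, pow_succ' (d K i) s, mul_assoc (d K i), h,
    mul_one, pow_succ' (d K i) t, sub_self]

theorem toLeftRegQuot_eq_zero_of_mem_idealA [CharZero K] {r : II K n} (hr : r ∈ idealA K n) :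
    toLeftRegQuot (II K n) r = 0 := by
  rw [← TwoSidedIdeal.mem_ker]
  refine (iSup_le fun i => TwoSidedIdeal.span_le.mpr ?_ :
    (⨆ i : Fin n, primeP K i) ≤ TwoSidedIdeal.ker (toLeftRegQuot (II K n)))
    (TwoSidedIdeal.mem_asIdeal.mp hr)
  rintro _ ⟨⟨s, t⟩, rfl⟩
  rw [SetLike.mem_coe, TwoSidedIdeal.mem_ker]
  have h := congrArg (toLeftRegQuot (II K n)) (d_pow_mul_e i s t)
  have hu := isUnit_toLeftRegQuot_dPow (K := K) (Pi.single i 1)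
  rw [dPow_single] at hu
  rw [map_mul, map_pow, map_zero] at h
  exact (hu.pow _).mul_right_eq_zero.mp h

/-- The homomorphism `𝕀_n → 'Q(𝕀_n)` is injective on `Δ_n`: if `s c = 0` with `s` in `'S(𝕀_n)`,
then `∂^β s` is a nonzero element of `Δ_n` for some `β`, and `Δ_n` has no zero divisors. -/
theorem eq_zero_of_toLeftRegQuot_eq_zero [CharZero K] {c : II K n} (hc : c ∈ Delta K n)
    (h : toLeftRegQuot (II K n) c = 0) : c = 0 := by
  obtain ⟨s, hs, e⟩ := isLeftLocalization_toLeftRegQuot.exists_mul_eq_zero c h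
  obtain ⟨β, hβ⟩ := exists_dPow_mul_mem_Delta s
  refine eq_zero_of_mul_eq_zero hβ hc (by rw [mul_assoc, e, mul_zero]) fun h0 => ?_
  exact zero_notMem_leftRegular (h0 ▸ mul_mem_leftRegular (dPow_mem_leftRegular β)
    (largestLeftRegDen_subset_leftRegular hs))

/-- The elements `∂^α` are invertible modulo `𝔞_n`, because `1 - ∫_i ∂_i = e_{00}(i)`. -/
theorem mem_idealA_of_dPow_mul {r : II K n} (α : Fin n → ℕ) (h : dPow K α * r ∈ idealA K n) :
    r ∈ idealA K n := by
  refine dPow_induction (p := fun y => ∀ r, y * r ∈ idealA K n → r ∈ idealA K n)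
    (fun r hr => by rwa [one_mul] at hr) ?_ α r h
  intro i α ih r hr
  refine ih r ?_
  rw [mul_assoc] at hr
  generalize dPow K α * r = y at hr
  have he : e K i 0 0 ∈ idealA K n :=
    TwoSidedIdeal.mem_asIdeal.mpr
      (le_iSup (primeP K) i (TwoSidedIdeal.subset_span ⟨(0, 0), rfl⟩))
  have : y = e K i 0 0 * y + int K i * (d K i * y) := by
    simp only [e, pow_zero, zero_add, pow_one, mul_one, sub_mul, one_mul, mul_assoc,
      sub_add_cancel]
  rw [this]
  exact add_mem ((idealA K n).mul_mem_right _ he) ((idealA K n).mul_mem_left _ hr)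

theorem toLeftRegQuot_eq_zero_iff [CharZero K] {r : II K n} :
    toLeftRegQuot (II K n) r = 0 ↔ r ∈ idealA K n := by
  refine ⟨fun h => ?_, toLeftRegQuot_eq_zero_of_mem_idealA⟩
  obtain ⟨α, hα⟩ := exists_dPow_mul_mem_Delta r
  refine mem_idealA_of_dPow_mul α ?_
  rw [eq_zero_of_toLeftRegQuot_eq_zero hα (by rw [map_mul, h, mul_zero])]
  exact zero_mem _

/-! ### The sets of denominators -/

/-- Left multiplication by a suitable `∂^β` moves denominators and numerators into `Δ_n`. -/
theorem isLeftLocalization_lDelta [CharZero K] :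
    IsLeftLocalization (toLeftRegQuot (II K n)) (lDelta K n) where
  one_mem := ⟨one_mem _, isLeftLocalization_toLeftRegQuot.one_mem⟩
  mul_mem s hs t ht := ⟨mul_mem hs.1 ht.1, isLeftLocalization_toLeftRegQuot.mul_mem _ hs.2 _ ht.2⟩
  isUnit s hs := isLeftLocalization_toLeftRegQuot.isUnit s hs.2
  exists_mul_eq q := by
    obtain ⟨s, hs, r, e⟩ := isLeftLocalization_toLeftRegQuot.exists_mul_eq q
    obtain ⟨β, hβ⟩ := exists_dPow_mul_mem_Delta s
    refine ⟨dPow K β * s, ⟨hβ, isLeftLocalization_toLeftRegQuot.mul_mem _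
      (dPow_mem_largestLeftRegDen β) _ hs⟩, dPow K β * r, ?_⟩
    rw [map_mul, map_mul, mul_assoc, e]
  exists_mul_eq_zero r hr := by
    obtain ⟨β, hβ⟩ := exists_dPow_mul_mem_Delta r
    exact ⟨dPow K β, ⟨dPow_mem_Delta β, dPow_mem_largestLeftRegDen β⟩,
      eq_zero_of_toLeftRegQuot_eq_zero hβ (by rw [map_mul, hr, mul_zero])⟩

theorem isLeftLocalization_satDelta [CharZero K] :
    IsLeftLocalization (toLeftRegQuot (II K n)) (satDelta K n) := by
  have unit : ∀ s ∈ satDelta K n, IsUnit (toLeftRegQuot (II K n) s) := by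
    rintro s ⟨-, α, hα⟩
    have := isLeftLocalization_toLeftRegQuot.isUnit _ hα
    rw [map_mul] at this
    obtain ⟨u, hu⟩ := isUnit_toLeftRegQuot_dPow (K := K) α
    rwa [← hu, Units.isUnit_units_mul] at this
  refine isLeftLocalization_lDelta.mono
    (fun s hs => ⟨hs.1, 0, by rw [dPow_zero, one_mul]; exact hs.2⟩) ?_ unit
  intro s hs t ht
  have hst := (unit s hs).mul (unit t ht)
  obtain ⟨hs, α, hα⟩ := hs
  obtain ⟨ht, β, hβ⟩ := ht
  -- with `∂^β (∂^α s) = c ∂^β`, both factors of `∂^{β+α} s t = c (∂^β t)` are left regular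
  obtain ⟨c, -, e⟩ := exists_dPow_mul_eq β (mul_mem (dPow_mem_Delta α) hs)
  refine ⟨mul_mem hs ht, β + α, mem_largestLeftRegDen_iff.mpr ⟨?_, ?_⟩⟩
  · have hc : c ∈ leftRegular (II K n) := by
      refine mem_leftRegular_of_mul (v := dPow K β) ?_
      rw [← e]
      exact mul_mem_leftRegular (dPow_mem_leftRegular β) (largestLeftRegDen_subset_leftRegular hα)
    have : dPow K (β + α) * (s * t) = c * (dPow K β * t) := by
      rw [← mul_assoc c, ← e, dPow_add]
      simp only [mul_assoc]
    rw [this]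
    exact mul_mem_leftRegular hc (largestLeftRegDen_subset_leftRegular hβ)
  · rw [map_mul, map_mul]
    exact (isUnit_toLeftRegQuot_dPow _).mul hst

theorem lDelta_subset_llDeltaCore : lDelta K n ⊆ llDeltaCore K n := fun s hs =>
  ⟨hs.2, s, ⟨⟨s, hs.1, 0, zero_mem (idealA K n), add_zero s⟩,
    fun r _ => largestLeftRegDen_subset_leftRegular hs.2 r⟩, 0, zero_mem (idealA K n), add_zero s⟩

theorem isLeftLocalization_llDeltaCore [CharZero K] :
    IsLeftLocalization (toLeftRegQuot (II K n)) (llDeltaCore K n) := by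
  have hmul : ∀ s ∈ (Delta K n : Set (II K n)) + (idealA K n : Set (II K n)),
      ∀ t ∈ (Delta K n : Set (II K n)) + (idealA K n : Set (II K n)),
      s * t ∈ (Delta K n : Set (II K n)) + (idealA K n : Set (II K n)) := by
    rintro _ ⟨s, hs, a, ha, rfl⟩ _ ⟨t, ht, b, hb, rfl⟩
    refine ⟨s * t, mul_mem hs ht, s * b + a * (t + b), add_mem
      ((idealA K n).mul_mem_left _ hb) ((idealA K n).mul_mem_right _ ha), ?_⟩
    change s * t + (s * b + a * (t + b)) = (s + a) * (t + b)
    noncomm_ring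
  refine isLeftLocalization_lDelta.mono lDelta_subset_llDeltaCore ?_
    fun s hs => isLeftLocalization_toLeftRegQuot.isUnit s hs.1
  rintro _ ⟨hs, u, hu, a, ha, rfl⟩ _ ⟨ht, v, hv, b, hb, rfl⟩
  refine ⟨isLeftLocalization_toLeftRegQuot.mul_mem _ hs _ ht, u * v, ⟨hmul _ hu.1 _ hv.1, ?_⟩,
    u * b + a * (v + b), add_mem ((idealA K n).mul_mem_left _ hb)
      ((idealA K n).mul_mem_right _ ha), ?_⟩
  · intro r hr e
    rw [← mul_assoc] at e
    exact hu.2 r hr (hv.2 _ (hmul _ hr _ hu.1) e)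
  · change u * v + (u * b + a * (v + b)) = (u + a) * (v + b)
    noncomm_ring

theorem IsLeftLocalization.localizesToQuot [CharZero K] {S : Set (II K n)}
    (h : IsLeftLocalization (toLeftRegQuot (II K n)) S) : LocalizesToQuot K n S :=
  ⟨⟨h.isLeftDenominatorSet, by
    rw [h.leftAss_eq]
    exact Set.ext fun r => toLeftRegQuot_eq_zero_iff⟩, h.isoOver _⟩

theorem IsLeftLocalization.factorLocalizesToQuot [CharZero K] {S : Set (II K n)}
    (h : IsLeftLocalization (toLeftRegQuot (II K n)) S) :
    FactorLocalizesToQuot K n (proj K n '' S) := by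
  let ψ : II K n ⧸ idealA K n →+* LeftRegQuot (II K n) :=
    Ideal.Quotient.lift _ (toLeftRegQuot (II K n)) fun _ => toLeftRegQuot_eq_zero_of_mem_idealA
  have hψ : Function.Injective ψ := by
    refine (injective_iff_map_eq_zero ψ).mpr fun y hy => ?_
    obtain ⟨r, rfl⟩ := Ideal.Quotient.mk_surjective y
    exact Ideal.Quotient.eq_zero_iff_mem.mpr (toLeftRegQuot_eq_zero_iff.mp hy)
  have h' : IsLeftLocalization ψ (proj K n '' S) := IsLeftLocalization.image (p := proj K n) h hψ
  refine ⟨⟨h'.isLeftDenominatorSet, ?_⟩, ?_⟩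
  · rw [h'.leftAss_eq]
    ext y
    exact map_eq_zero_iff ψ hψ
  · obtain ⟨E, hE⟩ := h'.isoOver h'.isLeftDenominatorSet
    exact ⟨E, fun r => hE (proj K n r)⟩

theorem isLeftLocalization_preimage_lDelta [CharZero K] :
    IsLeftLocalization ((toLeftRegQuot (II K n)).comp (Delta K n).val.toRingHom)
      ((↑) ⁻¹' lDelta K n : Set (Delta K n)) where
  one_mem := isLeftLocalization_lDelta.one_mem
  mul_mem s hs t ht := isLeftLocalization_lDelta.mul_mem _ hs _ ht
  isUnit s hs := isLeftLocalization_lDelta.isUnit _ hs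
  exists_mul_eq q := by
    obtain ⟨s, hs, r, e⟩ := isLeftLocalization_lDelta.exists_mul_eq q
    obtain ⟨β, hβ⟩ := exists_dPow_mul_mem_Delta r
    refine ⟨⟨dPow K β * s, mul_mem (dPow_mem_Delta β) hs.1⟩,
      isLeftLocalization_lDelta.mul_mem _
        ⟨dPow_mem_Delta β, dPow_mem_largestLeftRegDen β⟩ _ hs, ⟨dPow K β * r, hβ⟩, ?_⟩
    change toLeftRegQuot (II K n) (dPow K β * s) * q = toLeftRegQuot (II K n) (dPow K β * r)
    rw [map_mul, map_mul, mul_assoc, e]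
  exists_mul_eq_zero r hr := ⟨1, isLeftLocalization_lDelta.one_mem, by
    rw [one_mul]
    exact Subtype.ext (eq_zero_of_toLeftRegQuot_eq_zero r.2 hr)⟩

theorem injOn_proj_Delta [CharZero K] :
    Set.InjOn (proj K n) (Delta K n : Set (II K n)) := fun _ hc _ hc' h =>
  sub_eq_zero.mp <| eq_zero_of_toLeftRegQuot_eq_zero (sub_mem hc hc') <|
    toLeftRegQuot_eq_zero_of_mem_idealA (Ideal.Quotient.eq.mp h)

theorem isMultiplicativeSet_leftRegular_inter_Delta :
    IsMultiplicativeSet (leftRegular (II K n) ∩ (Delta K n : Set (II K n))) where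
  one_mem := ⟨one_mem_leftRegular, one_mem _⟩
  mul_mem _ hs _ ht := ⟨mul_mem_leftRegular hs.1 ht.1, mul_mem hs.2 ht.2⟩
  zero_notMem h := zero_notMem_leftRegular h.1

theorem isGreatest_lDelta [CharZero K] :
    IsGreatest {S : Set (II K n) | IsLeftDenominatorSet S ∧
      S ⊆ leftRegular (II K n) ∩ (Delta K n : Set (II K n))} (lDelta K n) :=
  ⟨⟨isLeftLocalization_lDelta.isLeftDenominatorSet,
    fun _ hs => ⟨largestLeftRegDen_subset_leftRegular hs.2, hs.1⟩⟩,
    fun _ hS _ hs => ⟨(hS.2 hs).2,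
      (isGreatest_largestLeftRegDen (II K n)).2 ⟨hS.1, fun _ ht => (hS.2 ht).1⟩ hs⟩⟩

theorem subset_add_idealA (S : Set (II K n)) : S ⊆ S + (idealA K n : Set (II K n)) :=
  fun s hs => ⟨s, hs, 0, zero_mem (idealA K n), add_zero s⟩

end Operators

end IntDiff

open IntDiff in
theorem mainTheorem5 (K : Type*) [Field K] [CharZero K] (n : ℕ) :
    -- 1. the set `'Δ_n`
    (IntDiff.LocalizesToQuot K n (IntDiff.lDelta K n) ∧
      IntDiff.IsMultiplicativeSet
        (IntDiff.leftRegular (IntDiff.II K n) ∩ (IntDiff.Delta K n : Set (IntDiff.II K n))) ∧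
      IsGreatest
        {S : Set (IntDiff.II K n) | IntDiff.IsLeftDenominatorSet S ∧
          S ⊆ IntDiff.leftRegular (IntDiff.II K n) ∩
            (IntDiff.Delta K n : Set (IntDiff.II K n))}
        (IntDiff.lDelta K n)) ∧
    -- 2. the sets `'Δ_n + 𝔞_n` and `'S(𝕀_n) + 𝔞_n`
    (IntDiff.LocalizesToQuot K n
        (IntDiff.lDelta K n + (IntDiff.idealA K n : Set (IntDiff.II K n))) ∧
      IntDiff.LocalizesToQuot K n
        (IntDiff.largestLeftRegDen (IntDiff.II K n) +
          (IntDiff.idealA K n : Set (IntDiff.II K n)))) ∧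
    -- 3. their images in `𝕀_n/𝔞_n`; `Δ_n`, hence `'Δ_n`, is identified with its image
    (Set.InjOn (IntDiff.proj K n) (IntDiff.Delta K n : Set (IntDiff.II K n)) ∧
      IntDiff.FactorLocalizesToQuot K n (IntDiff.proj K n '' IntDiff.lDelta K n) ∧
      IntDiff.FactorLocalizesToQuot K n (IntDiff.proj K n ''
        (IntDiff.lDelta K n + (IntDiff.idealA K n : Set (IntDiff.II K n)))) ∧
      IntDiff.FactorLocalizesToQuot K n (IntDiff.proj K n ''
        (IntDiff.largestLeftRegDen (IntDiff.II K n) +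
          (IntDiff.idealA K n : Set (IntDiff.II K n))))) ∧
    -- 4. the saturation of `'Δ_n` and its image
    (IntDiff.LocalizesToQuot K n (IntDiff.satDelta K n) ∧
      IntDiff.FactorLocalizesToQuot K n (IntDiff.proj K n '' IntDiff.satDelta K n)) ∧
    -- 5. the saturation of `'Δ_n` plus `𝔞_n`
    IntDiff.LocalizesToQuot K n
      (IntDiff.satDelta K n + (IntDiff.idealA K n : Set (IntDiff.II K n))) ∧
    -- 6. `'Δ_n` as a subset of the ring `Δ_n`
    (∃ h : IntDiff.IsLeftDenominatorSetWith
        ((↑) ⁻¹' IntDiff.lDelta K n : Set (IntDiff.Delta K n)) ⊥,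
      IntDiff.IsoOver h.toIsLeftDenominatorSet.toLoc
        ((IntDiff.toLeftRegQuot (IntDiff.II K n)).comp
          (IntDiff.Delta K n).val.toRingHom)) ∧
    -- 7. the set `''Δ_n` (and the other bracketing of the expression that defines it)
    (IntDiff.LocalizesToQuot K n (IntDiff.llDelta K n) ∧
      IntDiff.lDelta K n ⊆ IntDiff.llDelta K n ∧
      IntDiff.LocalizesToQuot K n (IntDiff.llDeltaCore K n) ∧
      IntDiff.lDelta K n ⊆ IntDiff.llDeltaCore K n) := by
  have hΔ := isLeftLocalization_lDelta (K := K) (n := n)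
  have hS := isLeftLocalization_toLeftRegQuot (R := II K n)
  have hsat := isLeftLocalization_satDelta (K := K) (n := n)
  have hcore := isLeftLocalization_llDeltaCore (K := K) (n := n)
  have h𝔞 (a : II K n) (ha : a ∈ idealA K n) : toLeftRegQuot (II K n) a = 0 :=
    toLeftRegQuot_eq_zero_of_mem_idealA ha
  have hΔ' := isLeftLocalization_preimage_lDelta (K := K) (n := n)
  refine ⟨⟨hΔ.localizesToQuot, isMultiplicativeSet_leftRegular_inter_Delta, isGreatest_lDelta⟩,
    ⟨(hΔ.add_ideal _ h𝔞).localizesToQuot, (hS.add_ideal _ h𝔞).localizesToQuot⟩,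
    ⟨injOn_proj_Delta, hΔ.factorLocalizesToQuot, (hΔ.add_ideal _ h𝔞).factorLocalizesToQuot,
      (hS.add_ideal _ h𝔞).factorLocalizesToQuot⟩,
    ⟨hsat.localizesToQuot, hsat.factorLocalizesToQuot⟩,
    (hsat.add_ideal _ h𝔞).localizesToQuot,
    ⟨⟨hΔ'.isLeftDenominatorSet, ?_⟩, hΔ'.isoOver _⟩,
    ⟨(hcore.add_ideal _ h𝔞).localizesToQuot,
      lDelta_subset_llDeltaCore.trans (subset_add_idealA _), hcore.localizesToQuot,
      lDelta_subset_llDeltaCore⟩⟩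
  rw [hΔ'.leftAss_eq]
  ext c
  refine ⟨fun hc => Subtype.ext (eq_zero_of_toLeftRegQuot_eq_zero c.2 hc), ?_⟩
  rintro rfl
  exact map_zero _
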